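/- All topological spaces are assumed to be Hausdorff. A topological semigroup is a topological space with a jointly continuous associative multiplication. A space is called pseudocompact if it is Tychonoff and every continuous real-valued function on it is bounded. A semigroup is called simple if it has no two-sided ideal (a nonempty subset $I$ with $SI\cup IS\subseteq I$) other than $S$ itself. For a group $H$, nonempty sets $X,Y$ and a map $\sigma:Y\times X\to H$, the Rees product $[X,H,Y]_\sigma$ is the set $X\times H\times Y$ with the multiplication $(x,h,y)\cdot(x',h',y')=(x,h\,\sigma(y,x')\,h',y')$. A topological semigroup $S$ is called a topological paragroup if, for some topological group $H$, some nonempty topological spaces $X,Y$ and some continuous map $\sigma:Y\times X\to H$, it is topologically isomorphic (by a semigroup isomorphism that is a homeomorphism) to $[X,H,Y]_\sigma$ endowed with the product topology. **Theorem.** Let $S$ be a topological semigroup whose square $S\times S$ is pseudocompact. Then $S$ is a topological paragroup if and only if $S$ is simple and contains an idempotent. -/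

import Mathlib

universe u v w

/-- A space is pseudocompact if it is Tychonoff and every continuous real-valued function on it
is bounded. -/
def IsPseudocompact (X : Type u) [TopologicalSpace X] : Prop :=
  T35Space X ∧ ∀ f : X → ℝ, Continuous f → ∃ C : ℝ, ∀ x, |f x| ≤ C

/-- A two-sided ideal of a semigroup: a nonempty subset absorbing multiplication on both sides. -/
def IsTwoSidedSemigroupIdeal {S : Type u} [Semigroup S] (I : Set S) : Prop :=
  I.Nonempty ∧ ∀ s : S, ∀ x ∈ I, s * x ∈ I ∧ x * s ∈ I

/-- A semigroup is simple if it has no proper two-sided ideal. -/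
def IsSimpleSemigroup (S : Type u) [Semigroup S] : Prop :=
  ∀ I : Set S, IsTwoSidedSemigroupIdeal I → I = Set.univ

/-- The underlying space `X × H × Y` of the Rees product of `H` over `X` and `Y` relative to the
sandwich map `σ`. -/
def ReesProduct {X : Type u} {H : Type v} {Y : Type w} (_σ : Y × X → H) : Type (max u v w) :=
  X × H × Y

namespace ReesProduct

variable {X : Type u} {H : Type v} {Y : Type w}

/-- The Rees product carries the product topology. -/
instance instTopologicalSpace [TopologicalSpace X] [TopologicalSpace H] [TopologicalSpace Y]
    (σ : Y × X → H) : TopologicalSpace (ReesProduct σ) :=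
  inferInstanceAs (TopologicalSpace (X × H × Y))

/-- The multiplication `(x, h, y) * (x', h', y') = (x, h * σ (y, x') * h', y')`. -/
instance instSemigroup [Group H] (σ : Y × X → H) : Semigroup (ReesProduct σ) where
  mul a b := ((a.1, a.2.1 * σ (a.2.2, b.1) * b.2.1, b.2.2) : X × H × Y)
  mul_assoc a b c := by
    change ((_, _, _) : X × H × Y) = (_, _, _)
    exact congrArg (fun h : H => ((a.1, h, c.2.2) : X × H × Y))
      (by change a.2.1 * σ (a.2.2, b.1) * b.2.1 * σ (b.2.2, c.1) * c.2.1
            = a.2.1 * σ (a.2.2, b.1) * (b.2.1 * σ (b.2.2, c.1) * c.2.1)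
          simp only [mul_assoc])

end ReesProduct

/-- `S` is a topological paragroup if it is topologically isomorphic to the Rees product of a
(Hausdorff) topological group `H` over nonempty Hausdorff spaces `X`, `Y` relative to a
continuous sandwich map. The spaces may be taken in the universe of `S`, since each of them embeds
in `X × H × Y`. -/
def IsTopologicalParagroup (S : Type u) [Semigroup S] [TopologicalSpace S] : Prop :=
  ∃ (X H Y : Type u) (_ : TopologicalSpace X) (_ : TopologicalSpace H) (_ : TopologicalSpace Y)
    (_ : Group H) (σ : Y × X → H),
    Nonempty X ∧ Nonempty Y ∧ T2Space X ∧ T2Space H ∧ T2Space Y ∧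
      IsTopologicalGroup H ∧ Continuous σ ∧ Nonempty (S ≃ₜ* ReesProduct σ)

/-!
The substantial direction rests on the following form of Glicksberg's theorem: if `X × Y` is
pseudocompact, then the sections `F (·, y)` of a continuous function `F` on `X × Y` are
equicontinuous, so that every sequence in `X` has two terms at which all sections nearly agree.
Applied to `F (x, y) = f (x * y)`, this shows that in a topological monoid with pseudocompact square
`a * b = 1` forces `b * a = 1`, and that a group with continuous multiplication and pseudocompact
square has continuous inversion.

Let `e` be an idempotent of the simple semigroup `S`. The monoid `e S e` is a retract of `S`, so its
square is pseudocompact; simplicity and the first consequence make it a group, and the second one a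
topological group. Writing `g` for the inverse of `e * s * e` in `e S e`, every `s` is recovered as
`s = (s * g) * (e * s * e) * (g * s)`, where the three factors depend continuously on `s`; these are
the Rees coordinates of `s`.
-/

open Filter Set Topology Uniformity

namespace IsPseudocompact

variable {X Y Z α : Type*} [TopologicalSpace X] [TopologicalSpace Y] [TopologicalSpace Z]

theorem of_surjective (hX : IsPseudocompact X) [T35Space Y] {g : X → Y} (hg : Continuous g)
    (hsurj : Function.Surjective g) : IsPseudocompact Y := by
  refine ⟨inferInstance, fun f hf => ?_⟩
  obtain ⟨C, hC⟩ := hX.2 (f ∘ g) (hf.comp hg)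
  exact ⟨C, hsurj.forall.2 hC⟩

theorem fst [Nonempty Y] (h : IsPseudocompact (X × Y)) : IsPseudocompact X := by
  obtain ⟨y⟩ := ‹Nonempty Y›
  have := h.1
  have : T35Space X := (isEmbedding_prodMkLeft y).t35Space
  exact h.of_surjective continuous_fst fun x => ⟨(x, y), rfl⟩

theorem not_locallyFinite (hZ : IsPseudocompact Z) {O : ℕ → Set Z} (hO : ∀ n, IsOpen (O n))
    (hne : ∀ n, (O n).Nonempty) : ¬LocallyFinite O := by
  intro hfin
  have := hZ.1
  choose z hz using hne
  choose b hb hbz hbO using fun n =>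
    CompletelyRegularSpace.completely_regular_isOpen (z n) (O n) (hO n) (hz n)
  let bump (n : ℕ) (x : Z) : ℝ := n * (1 - (b n x : ℝ))
  have bump_apply (n : ℕ) : bump n (z n) = n := by simp [bump, hbz]
  have bump_nonneg (n : ℕ) (x : Z) : 0 ≤ bump n x :=
    mul_nonneg n.cast_nonneg (sub_nonneg.2 (b n x).2.2)
  have support_bump (n : ℕ) : Function.support (bump n) ⊆ O n := fun x hx => by
    by_contra hxO
    have hbx : b n x = 1 := hbO n hxO
    exact hx (by simp [bump, hbx])
  have hsupp : LocallyFinite fun n => Function.support (bump n) := hfin.subset support_bump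
  have hcont : Continuous fun x => ∑ᶠ n, bump n x :=
    continuous_finsum (fun n => by have := hb n; fun_prop) hsupp
  obtain ⟨C, hC⟩ := hZ.2 _ hcont
  obtain ⟨n, hn⟩ := exists_nat_gt C
  have hle : (n : ℝ) ≤ C := calc
    (n : ℝ) = bump n (z n) := (bump_apply n).symm
    _ ≤ ∑ᶠ i, bump i (z n) :=
      single_le_finsum n (hsupp.point_finite (z n)) fun i => bump_nonneg i (z n)
    _ ≤ C := (le_abs_self _).trans (hC (z n))
  exact hle.not_gt hn

theorem exists_frequently_inter_nonempty (hZ : IsPseudocompact Z) {O : ℕ → Set Z}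
    (hO : ∀ n, IsOpen (O n)) (hne : ∀ n, (O n).Nonempty) :
    ∃ z, ∀ N ∈ 𝓝 z, ∃ᶠ n in atTop, (O n ∩ N).Nonempty := by
  by_contra hcon
  push Not at hcon
  refine hZ.not_locallyFinite hO hne fun z => ?_
  obtain ⟨N, hN, hempty⟩ := hcon z
  refine ⟨N, hN, not_infinite.1 fun hinf => ?_⟩
  obtain ⟨n, hn, hn'⟩ := ((Nat.frequently_atTop_iff_infinite.2 hinf).and_eventually hempty).exists
  exact hn.ne_empty hn'

theorem exists_lt_mem_uniformity [UniformSpace α] (hX : IsPseudocompact X) {f : X → α}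
    (hf : Continuous f) (x : ℕ → X) {V : SetRel α α} (hV : V ∈ 𝓤 α) :
    ∃ m n, m < n ∧ (f (x m), f (x n)) ∈ V := by
  obtain ⟨V', hV', hsymm', hcomp'⟩ := comp_symm_mem_uniformity_sets hV
  obtain ⟨W, hW, hopen, hsymm, hcomp⟩ := comp_open_symm_mem_uniformity_sets hV'
  have hball (a : X) : f ⁻¹' UniformSpace.ball (f a) W ∈ 𝓝 a :=
    hf.continuousAt (UniformSpace.ball_mem_nhds _ hW)
  obtain ⟨z, hz⟩ := hX.exists_frequently_inter_nonempty
    (fun n => (UniformSpace.isOpen_ball (f (x n)) hopen).preimage hf)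
    (fun n => ⟨x n, mem_of_mem_nhds (hball (x n))⟩)
  have hfreq : ∃ᶠ n in atTop, (f (x n), f z) ∈ V' := (hz _ (hball z)).mono fun n ⟨a, han, haz⟩ =>
    hcomp ⟨f a, han, hsymm.symm _ _ haz⟩
  obtain ⟨m, hm⟩ := hfreq.exists
  obtain ⟨n, hmn, hn⟩ := frequently_atTop'.1 hfreq m
  exact ⟨m, n, hmn, hcomp' ⟨f z, hm, hsymm'.symm _ _ hn⟩⟩

/-- Both `d ≤ G (x, y)` and `G (x, y) ≤ c` hold at an accumulation point `(x, y)` of the rectangles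
`U n ×ˢ V n`. -/
theorem le_of_diag_le_of_offDiag_le (h : IsPseudocompact (X × Y)) {G : X × Y → ℝ}
    (hG : Continuous G) {U : ℕ → Set X} {V : ℕ → Set Y} {c d : ℝ} (hU : ∀ n, IsOpen (U n))
    (hV : ∀ n, IsOpen (V n)) (hne : ∀ n, (U n ×ˢ V n).Nonempty)
    (hd : ∀ n, ∀ p ∈ U n ×ˢ V n, d ≤ G p)
    (hc : ∀ m n, m < n → ∀ p ∈ U n ×ˢ V m, G p ≤ c) : d ≤ c := by
  obtain ⟨⟨x, y⟩, hxy⟩ :=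
    h.exists_frequently_inter_nonempty (fun n => (hU n).prod (hV n)) hne
  have hxy_mem : (x, y) ∈ closure (⋃ n, U n ×ˢ V n) := mem_closure_iff_nhds.2 fun N hN => by
    obtain ⟨n, p, hp, hpN⟩ := (hxy N hN).exists
    exact ⟨p, hpN, mem_iUnion.2 ⟨n, hp⟩⟩
  have hx_mem (m : ℕ) : x ∈ closure (⋃ n > m, U n) := mem_closure_iff_nhds.2 fun N hN => by
    obtain ⟨n, hmn, p, hp, hpN⟩ :=
      frequently_atTop'.1 (hxy (N ×ˢ univ) (prod_mem_nhds hN univ_mem)) m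
    exact ⟨p.1, hpN.1, mem_biUnion hmn hp.1⟩
  have hy_mem : y ∈ closure (⋃ m, V m) := mem_closure_iff_nhds.2 fun N hN => by
    obtain ⟨n, p, hp, hpN⟩ := (hxy (univ ×ˢ N) (prod_mem_nhds univ_mem hN)).exists
    exact ⟨p.2, hpN.2, mem_iUnion.2 ⟨n, hp.2⟩⟩
  have hGx (m : ℕ) : ∀ b ∈ V m, G (x, b) ≤ c := fun b hb =>
    closure_minimal (t := {a | G (a, b) ≤ c})
      (iUnion₂_subset fun n hmn a ha => hc m n hmn (a, b) ⟨ha, hb⟩)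
      (isClosed_le (by fun_prop) continuous_const) (hx_mem m)
  calc
    d ≤ G (x, y) := closure_minimal (t := {p | d ≤ G p}) (iUnion_subset hd)
      (isClosed_le continuous_const hG) hxy_mem
    _ ≤ c := closure_minimal (t := {b | G (x, b) ≤ c}) (iUnion_subset hGx)
      (isClosed_le (by fun_prop) continuous_const) hy_mem

theorem eventually_forall_lt_of_apply_eq_zero (h : IsPseudocompact (X × Y)) {G : X × Y → ℝ}
    (hG : Continuous G) {x₀ : X} (hG₀ : ∀ y, G (x₀, y) = 0) {ε : ℝ} (hε : 0 < ε) :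
    ∀ᶠ x in 𝓝 x₀, ∀ y, G (x, y) < ε := by
  by_contra hcon
  suffices hseq : ∃ R : ℕ → Set X × Set Y,
      (∀ n, (IsOpen (R n).1 ∧ IsOpen (R n).2 ∧ ((R n).1 ×ˢ (R n).2).Nonempty ∧
          ∀ p ∈ (R n).1 ×ˢ (R n).2, ε / 2 ≤ G p) ∧
        ∀ᶠ a in 𝓝 x₀, ∀ b ∈ (R n).2, G (a, b) ≤ ε / 3) ∧
      ∀ m n, m < n → ∀ p ∈ (R n).1 ×ˢ (R m).2, G p ≤ ε / 3 by
    obtain ⟨R, hR, hlt⟩ := hseq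
    have := h.le_of_diag_le_of_offDiag_le hG (fun n => (hR n).1.1) (fun n => (hR n).1.2.1)
      (fun n => (hR n).1.2.2.1) (fun n => (hR n).1.2.2.2) hlt
    linarith
  refine exists_seq_of_forall_finset_exists (fun R : Set X × Set Y =>
      (IsOpen R.1 ∧ IsOpen R.2 ∧ (R.1 ×ˢ R.2).Nonempty ∧ ∀ p ∈ R.1 ×ˢ R.2, ε / 2 ≤ G p) ∧
        ∀ᶠ a in 𝓝 x₀, ∀ b ∈ R.2, G (a, b) ≤ ε / 3)
    (fun R R' => ∀ p ∈ R'.1 ×ˢ R.2, G p ≤ ε / 3) fun s hs => ?_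
  obtain ⟨W, hsmall, hW, hx₀W⟩ := eventually_nhds_iff.1
    ((eventually_all_finset s).2 fun R hR => (hs R hR).2)
  obtain ⟨x, hxW, y, hxy⟩ : ∃ x ∈ W, ∃ y, ε ≤ G (x, y) := by
    by_contra! hlt
    exact hcon (mem_of_superset (hW.mem_nhds hx₀W) hlt)
  obtain ⟨U, V, hU, hxU, hV, hyV, hlarge⟩ := mem_nhds_prod_iff'.1
    (hG.continuousAt.eventually (lt_mem_nhds (show ε / 2 < G (x, y) by linarith)))
  obtain ⟨A, B, hA, hxA, hB, hyB, hAB⟩ := mem_nhds_prod_iff'.1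
    (hG.continuousAt.eventually (gt_mem_nhds (show G (x₀, y) < ε / 3 by rw [hG₀]; linarith)))
  refine ⟨(U ∩ W, V ∩ B), ⟨⟨hU.inter hW, hV.inter hB, ⟨(x, y), ⟨hxU, hxW⟩, hyV, hyB⟩, ?_⟩, ?_⟩, ?_⟩
  · exact fun p hp => (hlarge ⟨hp.1.1, hp.2.1⟩).le
  · filter_upwards [hA.mem_nhds hxA] with a ha b hb using (hAB ⟨ha, hb.2⟩).le
  · exact fun R hR p hp => hsmall p.1 hp.1.2 R hR p.2 hp.2

theorem equicontinuous_sections [PseudoMetricSpace α] (h : IsPseudocompact (X × Y))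
    {F : X × Y → α} (hF : Continuous F) : Equicontinuous fun y x => F (x, y) := by
  intro x₀
  rw [Metric.equicontinuousAt_iff_right]
  intro ε hε
  exact h.eventually_forall_lt_of_apply_eq_zero (G := fun p => dist (F (x₀, p.2)) (F p))
    (by fun_prop) (fun y => dist_self _) hε

theorem exists_lt_forall_dist_lt [PseudoMetricSpace α] (h : IsPseudocompact (X × Y))
    {F : X × Y → α} (hF : Continuous F) (x : ℕ → X) {ε : ℝ} (hε : 0 < ε) :
    ∃ m n, m < n ∧ ∀ y, dist (F (x m, y)) (F (x n, y)) < ε := by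
  cases isEmpty_or_nonempty Y
  · exact ⟨0, 1, one_pos, isEmptyElim⟩
  · have hcont := equicontinuous_iff_continuous.1 (h.equicontinuous_sections hF)
    exact h.fst.exists_lt_mem_uniformity hcont x
      ((UniformFun.hasBasis_uniformity Y α).mem_of_mem (Metric.dist_mem_uniformity hε))

section Monoid

variable {M : Type*} [Monoid M] [TopologicalSpace M] [ContinuousMul M]

theorem exists_forall_dist_pow_succ_mul_lt [PseudoMetricSpace α] (h : IsPseudocompact (M × M))
    {f : M → α} (hf : Continuous f) {a b : M} (hab : a * b = 1) {ε : ℝ} (hε : 0 < ε) :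
    ∃ k : ℕ, ∀ y, dist (f y) (f (a ^ (k + 1) * y)) < ε := by
  obtain ⟨m, n, hmn, hdist⟩ := h.exists_lt_forall_dist_lt (F := fun p => f (p.1 * p.2))
    (by fun_prop) (fun n => a ^ n) hε
  obtain ⟨k, rfl⟩ := Nat.exists_eq_add_of_lt hmn
  have hpow : a ^ (m + k + 1) = a ^ (k + 1) * a ^ m := by
    rw [← pow_add, add_comm (k + 1), add_assoc]
  have hcancel (y : M) : a ^ m * (b ^ m * y) = y := by
    rw [← mul_assoc, pow_mul_pow_eq_one m hab, one_mul]
  refine ⟨k, fun y => ?_⟩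
  simpa only [hpow, mul_assoc, hcancel] using hdist (b ^ m * y)

theorem isDedekindFiniteMonoid (h : IsPseudocompact (M × M)) : IsDedekindFiniteMonoid M where
  mul_eq_one_symm := by
    intro a b hab
    have := h.fst.1
    by_contra hne
    obtain ⟨f, hf, hf_one, hf_eqOn⟩ := CompletelyRegularSpace.completely_regular
      (1 : M) {b * a} isClosed_singleton (Ne.symm hne)
    obtain ⟨k, hk⟩ := h.exists_forall_dist_pow_succ_mul_lt hf hab one_half_pos
    -- Left multiplication by `a ^ (k + 1)` moves `1` and `b * a` to the same point.
    have hpow : a ^ (k + 1) * (b * a) = a ^ (k + 1) * 1 := by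
      rw [pow_succ, mul_assoc, ← mul_assoc a b a, hab, one_mul, mul_one]
    have hlt : dist (f 1) (f (b * a)) < 1 := calc
      dist (f 1) (f (b * a))
          ≤ dist (f 1) (f (a ^ (k + 1) * 1)) + dist (f (b * a)) (f (a ^ (k + 1) * (b * a))) := by
        rw [hpow]; exact dist_triangle_right _ _ _
      _ < 1 / 2 + 1 / 2 := add_lt_add (hk 1) (hk (b * a))
      _ = 1 := add_halves 1
    have hf_mul : f (b * a) = 1 := hf_eqOn rfl
    simp [hf_one, hf_mul, Subtype.dist_eq] at hlt

end Monoid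

theorem isTopologicalGroup {H : Type*} [Group H] [TopologicalSpace H] [ContinuousMul H]
    (h : IsPseudocompact (H × H)) : IsTopologicalGroup H where
  continuous_inv := by
    have := h.fst.1
    refine continuous_iff_continuousAt.2 fun x₀ => (nhds_basis_opens _).tendsto_right_iff.2 ?_
    rintro O ⟨hx₀, hO⟩
    obtain ⟨f, hf, hf_inv, hf_compl⟩ :=
      CompletelyRegularSpace.completely_regular_isOpen x₀⁻¹ O hO hx₀
    have hequi := h.equicontinuous_sections (F := fun p => f (x₀⁻¹ * p.1 * p.2)) (by fun_prop)
    filter_upwards [Metric.equicontinuousAt_iff_right.1 (hequi x₀) 1 one_pos] with x hx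
    have hlt : dist (f x⁻¹) (f x₀⁻¹) < 1 := by
      simpa only [inv_mul_cancel, one_mul, mul_inv_cancel_right] using hx x⁻¹
    by_contra hxO
    have hf_x : f x⁻¹ = 1 := hf_compl hxO
    simp [hf_inv, hf_x, Subtype.dist_eq] at hlt

end IsPseudocompact

section Simple

variable {S T : Type*} [Semigroup S] [Semigroup T]

theorem isSimpleSemigroup_iff : IsSimpleSemigroup S ↔ ∀ a b : S, ∃ s t, s * a * t = b := by
  constructor
  · intro hS a b
    have hideal : IsTwoSidedSemigroupIdeal {b | ∃ s t, s * a * t = b} := by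
      refine ⟨⟨_, a, a, rfl⟩, ?_⟩
      rintro r _ ⟨s, t, rfl⟩
      exact ⟨⟨r * s, t, by simp only [mul_assoc]⟩, ⟨s, t * r, by simp only [mul_assoc]⟩⟩
    exact (hS _ hideal).ge (mem_univ b)
  · rintro h I ⟨⟨a, ha⟩, hI⟩
    refine eq_univ_of_forall fun b => ?_
    obtain ⟨s, t, rfl⟩ := h a b
    exact (hI t _ (hI s a ha).1).2

theorem IsSimpleSemigroup.of_surjective (hS : IsSimpleSemigroup S) {f : S →ₙ* T}
    (hf : Function.Surjective f) : IsSimpleSemigroup T := by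
  refine isSimpleSemigroup_iff.2 (hf.forall₂.2 fun a b => ?_)
  obtain ⟨s, t, rfl⟩ := isSimpleSemigroup_iff.1 hS a b
  exact ⟨f s, f t, by simp only [map_mul]⟩

end Simple

namespace ReesProduct

variable {X H Y : Type*} [Group H] (σ : Y × X → H)

theorem isSimpleSemigroup : IsSimpleSemigroup (ReesProduct σ) := by
  refine isSimpleSemigroup_iff.2 ?_
  rintro ⟨x, h, y⟩ ⟨x', h', y'⟩
  refine ⟨((x', h' * (σ (y, x) * h)⁻¹, y) : X × H × Y), ((x, (σ (y, x))⁻¹, y') : X × H × Y),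
    Prod.ext rfl (Prod.ext ?_ rfl)⟩
  change h' * (σ (y, x) * h)⁻¹ * σ (y, x) * h * σ (y, x) * (σ (y, x))⁻¹ = h'
  group

theorem exists_isIdempotentElem [Nonempty X] [Nonempty Y] :
    ∃ e : ReesProduct σ, IsIdempotentElem e := by
  obtain ⟨x⟩ := ‹Nonempty X›
  obtain ⟨y⟩ := ‹Nonempty Y›
  refine ⟨((x, (σ (y, x))⁻¹, y) : X × H × Y), Prod.ext rfl (Prod.ext ?_ rfl)⟩
  change (σ (y, x))⁻¹ * σ (y, x) * (σ (y, x))⁻¹ = (σ (y, x))⁻¹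
  group

end ReesProduct

section Corner

variable {S : Type*} [Semigroup S] {e : S} (he : IsIdempotentElem e)

/-- The corner `e S e` of a semigroup is a monoid with identity `e`. -/
instance cornerMonoid : Monoid he.Corner where
  __ : Semigroup he.Corner := inferInstanceAs (Semigroup (Subsemigroup.corner e))
  one := ⟨e, (Subsemigroup.mem_corner_iff he).2 ⟨he, he⟩⟩
  one_mul a := Subtype.ext ((Subsemigroup.mem_corner_iff he).1 a.2).1
  mul_one a := Subtype.ext ((Subsemigroup.mem_corner_iff he).1 a.2).2

/-- The retraction `s ↦ e * s * e` of a semigroup onto its corner `e S e`. -/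
def cornerProj (s : S) : he.Corner := ⟨e * s * e, s, rfl⟩

variable {he}

theorem idem_mul_corner (a : he.Corner) : e * a.1 = a.1 :=
  ((Subsemigroup.mem_corner_iff he).1 a.2).1

theorem corner_mul_idem (a : he.Corner) : a.1 * e = a.1 :=
  ((Subsemigroup.mem_corner_iff he).1 a.2).2

theorem cornerProj_coe (a : he.Corner) : cornerProj he a.1 = a :=
  Subtype.ext (by simp only [cornerProj, idem_mul_corner, corner_mul_idem])

theorem cornerProj_surjective : Function.Surjective (cornerProj he) :=
  fun a => ⟨a.1, cornerProj_coe a⟩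

theorem cornerProj_mul_mul (s : S) (a : he.Corner) (t : S) :
    cornerProj he s * a * cornerProj he t = cornerProj he (s * a.1 * t) :=
  Subtype.ext <| calc
    e * s * e * a.1 * (e * t * e) = e * s * (e * a.1 * e) * t * e := by simp only [mul_assoc]
    _ = e * (s * a.1 * t) * e := by
      simp only [idem_mul_corner, corner_mul_idem, mul_assoc]

section Topology

variable [TopologicalSpace S]

instance cornerTopologicalSpace : TopologicalSpace he.Corner :=
  inferInstanceAs (TopologicalSpace (Subsemigroup.corner e))

variable [ContinuousMul S]

instance continuousMul_corner : ContinuousMul he.Corner :=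
  inferInstanceAs (ContinuousMul (Subsemigroup.corner e))

theorem continuous_cornerProj : Continuous (cornerProj he) :=
  Continuous.subtype_mk (by fun_prop) _

theorem IsPseudocompact.corner_prod_corner (hS : IsPseudocompact (S × S)) :
    IsPseudocompact (he.Corner × he.Corner) := by
  have := hS.1
  have : T35Space (he.Corner × he.Corner) :=
    (IsEmbedding.subtypeVal.prodMap IsEmbedding.subtypeVal).t35Space
  exact hS.of_surjective (continuous_cornerProj.prodMap continuous_cornerProj)
    (cornerProj_surjective.prodMap cornerProj_surjective)

end Topology

variable (he) in
/-- The corner `e S e` is a group, that is, it coincides with the maximal subgroup of `S` at `e`.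
As a class it provides the group structure on `e S e`. -/
class IsGroupCorner : Prop where
  isUnit (a : he.Corner) : IsUnit a

noncomputable instance cornerGroup [IsGroupCorner he] : Group he.Corner :=
  groupOfIsUnit IsGroupCorner.isUnit

theorem IsSimpleSemigroup.isGroupCorner [IsDedekindFiniteMonoid he.Corner]
    (hS : IsSimpleSemigroup S) : IsGroupCorner he where
  isUnit a := by
    obtain ⟨s, t, hst⟩ := isSimpleSemigroup_iff.1 hS a.1 e
    have hone : cornerProj he s * a * cornerProj he t = 1 := by
      rw [cornerProj_mul_mul, hst]
      exact cornerProj_coe 1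
    exact isUnit_of_mul_isUnit_right (isUnit_of_mul_isUnit_left (hone ▸ isUnit_one))

/-- The first factor of the Rees product: the idempotents `x` in the `L`-class of `e`, that is,
those generating the same left ideal as `e`. -/
abbrev LClassIdempotent (e : S) : Type _ := {x : S // x * e = x ∧ e * x = e}

/-- The last factor of the Rees product: the idempotents `y` in the `R`-class of `e`, that is,
those generating the same right ideal as `e`. -/
abbrev RClassIdempotent (e : S) : Type _ := {y : S // e * y = y ∧ y * e = e}

variable (he) in
/-- The sandwich map of the Rees product associated with the idempotent `e`. -/
def cornerSandwich (p : RClassIdempotent e × LClassIdempotent e) : he.Corner :=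
  ⟨p.1.1 * p.2.1, (Subsemigroup.mem_corner_iff he).2
    ⟨by rw [← mul_assoc, p.1.2.1], by rw [mul_assoc, p.2.2.1]⟩⟩

theorem cornerProj_factor_mul (x : LClassIdempotent e) (h : he.Corner) (y : RClassIdempotent e) :
    cornerProj he (x.1 * h.1 * y.1) = h :=
  Subtype.ext <| calc
    e * (x.1 * h.1 * y.1) * e = e * x.1 * h.1 * (y.1 * e) := by simp only [mul_assoc]
    _ = h.1 := by rw [x.2.2, y.2.2, idem_mul_corner, corner_mul_idem]

section ReesCoordinates

variable [IsGroupCorner he]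

variable (he) in
/-- The inverse of `e * s * e` in the group `e S e`. -/
noncomputable def cornerInv (s : S) : he.Corner := (cornerProj he s)⁻¹

theorem idem_mul_mul_cornerInv (s : S) : e * s * (cornerInv he s).1 = e := calc
  e * s * (cornerInv he s).1 = e * s * e * (cornerInv he s).1 := by
    rw [mul_assoc _ e, idem_mul_corner]
  _ = e := congrArg Subtype.val (mul_inv_cancel (cornerProj he s))

theorem cornerInv_mul_mul_idem (s : S) : (cornerInv he s).1 * s * e = e := calc
  (cornerInv he s).1 * s * e = (cornerInv he s).1 * (e * s * e) := by
    simp only [← mul_assoc, corner_mul_idem]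
  _ = e := congrArg Subtype.val (inv_mul_cancel (cornerProj he s))

variable (he) in
/-- The `L`-class coordinate of an element of `S`, the first of its Rees coordinates. -/
noncomputable def lFactor (s : S) : LClassIdempotent e :=
  ⟨s * (cornerInv he s).1, by rw [mul_assoc, corner_mul_idem],
    by rw [← mul_assoc, idem_mul_mul_cornerInv]⟩

variable (he) in
/-- The `R`-class coordinate of an element of `S`, the last of its Rees coordinates. -/
noncomputable def rFactor (s : S) : RClassIdempotent e :=
  ⟨(cornerInv he s).1 * s, by rw [← mul_assoc, idem_mul_corner], cornerInv_mul_mul_idem s⟩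

theorem IsSimpleSemigroup.mul_cornerInv_mul (hS : IsSimpleSemigroup S) (s : S) :
    s * (cornerInv he s).1 * s = s := by
  obtain ⟨a, b, hab⟩ := isSimpleSemigroup_iff.1 hS e s
  set g := cornerInv he s
  have hg : e * (b * g.1) * e = e * (b * g.1) := by simp only [mul_assoc, corner_mul_idem]
  have hright : cornerProj he a * cornerProj he (b * g.1) = 1 := Subtype.ext <| calc
    e * a * e * (e * (b * g.1) * e) = e * (a * (e * e) * b) * g.1 := by
      rw [hg]; simp only [mul_assoc]
    _ = e := by rw [he.eq, hab, idem_mul_mul_cornerInv]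
  have hleft : cornerProj he (b * g.1) * cornerProj he a = 1 := mul_eq_one_comm.1 hright
  have hcancel : e * (b * g.1) * (e * a * e) = e := hg ▸ congrArg Subtype.val hleft
  calc
    s * g.1 * s = a * (e * (b * (g.1 * e)) * (a * e)) * b := by
      rw [corner_mul_idem, ← hab]; simp only [mul_assoc]
    _ = a * (e * (b * g.1) * (e * a * e)) * b := by simp only [mul_assoc]
    _ = s := by rw [hcancel, hab]

theorem IsSimpleSemigroup.lFactor_mul_cornerProj_mul_rFactor (hS : IsSimpleSemigroup S) (s : S) :
    (lFactor he s).1 * (cornerProj he s).1 * (rFactor he s).1 = s := by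
  set g := cornerInv he s with hg
  calc
    s * g.1 * (e * s * e) * (g.1 * s) = s * (g.1 * e) * s * (e * g.1) * s := by
      simp only [mul_assoc]
    _ = s := by rw [corner_mul_idem, idem_mul_corner, hg, hS.mul_cornerInv_mul,
      hS.mul_cornerInv_mul]

variable (x : LClassIdempotent e) (h : he.Corner) (y : RClassIdempotent e)

theorem cornerInv_factor_mul : cornerInv he (x.1 * h.1 * y.1) = h⁻¹ :=
  congrArg (·⁻¹) (cornerProj_factor_mul x h y)

theorem lFactor_factor_mul : lFactor he (x.1 * h.1 * y.1) = x :=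
  Subtype.ext <| calc
    x.1 * h.1 * y.1 * (cornerInv he (x.1 * h.1 * y.1)).1
        = x.1 * h.1 * y.1 * (e * (h⁻¹).1) := by rw [cornerInv_factor_mul, idem_mul_corner]
    _ = x.1 * (h.1 * (y.1 * e) * (h⁻¹).1) := by simp only [mul_assoc]
    _ = x.1 * (h * h⁻¹).1 := by rw [y.2.2, corner_mul_idem]; rfl
    _ = x.1 := by rw [mul_inv_cancel]; exact x.2.1

theorem rFactor_factor_mul : rFactor he (x.1 * h.1 * y.1) = y :=
  Subtype.ext <| calc
    (cornerInv he (x.1 * h.1 * y.1)).1 * (x.1 * h.1 * y.1)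
        = (h⁻¹).1 * e * (x.1 * h.1 * y.1) := by rw [cornerInv_factor_mul, corner_mul_idem]
    _ = (h⁻¹).1 * (e * x.1) * h.1 * y.1 := by simp only [mul_assoc]
    _ = (h⁻¹ * h).1 * y.1 := by rw [x.2.2, corner_mul_idem]; rfl
    _ = y.1 := by rw [inv_mul_cancel]; exact y.2.1

variable (he) in
/-- The Rees–Suschkewitsch representation of a simple semigroup with an idempotent `e` whose corner
`e S e` is a group. -/
noncomputable def reesEquiv (hS : IsSimpleSemigroup S) : ReesProduct (cornerSandwich he) ≃* S where
  toFun p := p.1.1 * p.2.1.1 * p.2.2.1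
  invFun s := ((lFactor he s, cornerProj he s, rFactor he s) :
    LClassIdempotent e × he.Corner × RClassIdempotent e)
  left_inv := fun ⟨x, h, y⟩ => Prod.ext (lFactor_factor_mul x h y)
    (Prod.ext (cornerProj_factor_mul x h y) (rFactor_factor_mul x h y))
  right_inv := hS.lFactor_mul_cornerProj_mul_rFactor
  map_mul' := by
    rintro ⟨x, h, y⟩ ⟨x', h', y'⟩
    change x.1 * (h.1 * (y.1 * x'.1) * h'.1) * y'.1 = x.1 * h.1 * y.1 * (x'.1 * h'.1 * y'.1)
    simp only [mul_assoc]

end ReesCoordinates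

section ReesTopology

variable [TopologicalSpace S] [ContinuousMul S]

theorem continuous_cornerSandwich : Continuous (cornerSandwich he) :=
  Continuous.subtype_mk (by fun_prop) _

variable [IsGroupCorner he] [ContinuousInv he.Corner]

theorem continuous_cornerInv : Continuous fun s => (cornerInv he s).1 :=
  have : Continuous (cornerInv he) := continuous_inv.comp continuous_cornerProj
  continuous_subtype_val.comp this

theorem continuous_lFactor : Continuous (lFactor he) :=
  (continuous_id.mul continuous_cornerInv).subtype_mk _

theorem continuous_rFactor : Continuous (rFactor he) :=
  (continuous_cornerInv.mul continuous_id).subtype_mk _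

variable (he) in
/-- The topological form of `reesEquiv`, for a corner with continuous inversion. -/
noncomputable def reesHomeomorph (hS : IsSimpleSemigroup S) :
    ReesProduct (cornerSandwich he) ≃ₜ* S where
  __ := reesEquiv he hS
  continuous_toFun := by
    change Continuous fun p : LClassIdempotent e × he.Corner × RClassIdempotent e =>
      p.1.1 * p.2.1.1 * p.2.2.1
    fun_prop
  continuous_invFun :=
    continuous_lFactor.prodMk (continuous_cornerProj.prodMk continuous_rFactor)

end ReesTopology

end Corner

theorem IsSimpleSemigroup.isTopologicalParagroup {S : Type*} [Semigroup S] [TopologicalSpace S]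
    [ContinuousMul S] [T2Space S] (hS : IsSimpleSemigroup S) {e : S} (he : IsIdempotentElem e)
    [IsGroupCorner he] [ContinuousInv he.Corner] : IsTopologicalParagroup S :=
  have : T2Space he.Corner := inferInstanceAs (T2Space (Subsemigroup.corner e))
  ⟨LClassIdempotent e, he.Corner, RClassIdempotent e, inferInstance, inferInstance, inferInstance,
    inferInstance, cornerSandwich he, ⟨⟨e, he, he⟩⟩, ⟨⟨e, he, he⟩⟩, inferInstance, inferInstance,
    inferInstance, { }, continuous_cornerSandwich, ⟨(reesHomeomorph he hS).symm⟩⟩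

theorem IsTopologicalParagroup.isSimpleSemigroup {S : Type*} [Semigroup S] [TopologicalSpace S]
    (hS : IsTopologicalParagroup S) : IsSimpleSemigroup S := by
  obtain ⟨X, H, Y, _, _, _, _, σ, _, _, -, -, -, -, -, ⟨φ⟩⟩ := hS
  exact (ReesProduct.isSimpleSemigroup σ).of_surjective (f := φ.symm.toMulEquiv.toMulHom)
    φ.symm.surjective

theorem IsTopologicalParagroup.exists_isIdempotentElem {S : Type*} [Semigroup S]
    [TopologicalSpace S] (hS : IsTopologicalParagroup S) : ∃ e : S, IsIdempotentElem e := by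
  obtain ⟨X, H, Y, _, _, _, _, σ, _, _, -, -, -, -, -, ⟨φ⟩⟩ := hS
  obtain ⟨e, he⟩ := ReesProduct.exists_isIdempotentElem σ
  exact ⟨φ.symm e, he.map φ.symm⟩

theorem mainTheorem3 (S : Type u) [Semigroup S] [TopologicalSpace S] [ContinuousMul S]
    (hS : IsPseudocompact (S × S)) :
    IsTopologicalParagroup S ↔ (IsSimpleSemigroup S ∧ ∃ e : S, IsIdempotentElem e) := by
  refine ⟨fun h => ⟨h.isSimpleSemigroup, h.exists_isIdempotentElem⟩, ?_⟩
  rintro ⟨hsimple, e, he⟩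
  have : Nonempty S := ⟨e⟩
  have : T35Space S := hS.fst.1
  have hcorner : IsPseudocompact (he.Corner × he.Corner) := hS.corner_prod_corner
  have : IsDedekindFiniteMonoid he.Corner := hcorner.isDedekindFiniteMonoid
  have : IsGroupCorner he := hsimple.isGroupCorner
  have : IsTopologicalGroup he.Corner := hcorner.isTopologicalGroup
  exact hsimple.isTopologicalParagroup he
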